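/- Let $\alpha\in(0,1)$, $\varphi_1>0$, and let $f:[\varphi_1,\infty)\to(0,\infty)$ be continuous, nonincreasing and radially decreasing (i.e. for every $\varphi\ge\varphi_1$ the sequence $k\mapsto f(\varphi+2k\pi)$, $k=0,1,2,\dots$, is strictly decreasing). Suppose that $f$ is piecewise continuously differentiable with finitely many smooth pieces in each compact interval: there is a set $S$ of break points, with $S\cap[\varphi_1,b]$ finite for every $b>\varphi_1$, such that $f$ is continuously differentiable on $(\varphi_1,\infty)\setminus S$. Assume that there are positive constants $\underline m,\overline m,\underline a,M$ such that for all $\varphi\ge\varphi_1$ $$\underline m\,\varphi^{-\alpha}\le f(\varphi)\le\overline m\,\varphi^{-\alpha},\qquad \underline a\,\varphi^{-\alpha-1}\le f(\varphi)-f(\varphi+2\pi),$$ and $|f'(\varphi)|\le M\varphi^{-\alpha-1}$ for all $\varphi>\varphi_1$ at which $f$ is differentiable. Let $\Gamma=\{(f(\varphi)\cos\varphi,\,f(\varphi)\sin\varphi):\varphi\ge\varphi_1\}\subset\mathbb R^2$ be the graph of $r=f(\varphi)$ in polar coordinates. Then the box dimension of $\Gamma$ exists and $$\dim_B\Gamma=\frac{2}{1+\alpha}.$$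 Here, for a bounded set $A\subset\mathbb R^N$ with open $\varepsilon$-neighbourhood $A_\varepsilon$ of Lebesgue measure $|A_\varepsilon|$, the lower and upper box dimensions are the infima of those $s\ge0$ for which, respectively, $\liminf_{\varepsilon\to0^+}|A_\varepsilon|/\varepsilon^{N-s}=0$ and $\limsup_{\varepsilon\to0^+}|A_\varepsilon|/\varepsilon^{N-s}=0$; $\dim_BA=d$ means that $A$ is bounded and both are equal to $d$. -/

import Mathlib

open scoped ENNReal NNReal Topology

/-- The quotient `|A_ε| / ε ^ (N - s)`, where `A_ε = {y | d(y, A) < ε}` is the open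
`ε`-neighbourhood of `A ⊆ ℝ^N` and `|A_ε|` is its Lebesgue measure. -/
noncomputable def minkowskiQuotient {N : ℕ} (s : ℝ) (A : Set (EuclideanSpace ℝ (Fin N)))
    (ε : ℝ) : ℝ≥0∞ :=
  MeasureTheory.volume (Metric.thickening ε A) / ENNReal.ofReal (ε ^ ((N : ℝ) - s))

/-- The lower `s`-dimensional Minkowski content. -/
noncomputable def lowerMinkowskiContent {N : ℕ} (s : ℝ)
    (A : Set (EuclideanSpace ℝ (Fin N))) : ℝ≥0∞ :=
  Filter.liminf (minkowskiQuotient s A) (𝓝[>] (0 : ℝ))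

/-- The upper `s`-dimensional Minkowski content. -/
noncomputable def upperMinkowskiContent {N : ℕ} (s : ℝ)
    (A : Set (EuclideanSpace ℝ (Fin N))) : ℝ≥0∞ :=
  Filter.limsup (minkowskiQuotient s A) (𝓝[>] (0 : ℝ))

/-- The lower box dimension `inf {s ≥ 0 | lower s-dimensional Minkowski content of A is 0}`. -/
noncomputable def lowerBoxDim {N : ℕ} (A : Set (EuclideanSpace ℝ (Fin N))) : ℝ≥0∞ :=
  ⨅ (s : ℝ≥0) (_ : lowerMinkowskiContent (s : ℝ) A = 0), (s : ℝ≥0∞)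

/-- The upper box dimension `inf {s ≥ 0 | upper s-dimensional Minkowski content of A is 0}`. -/
noncomputable def upperBoxDim {N : ℕ} (A : Set (EuclideanSpace ℝ (Fin N))) : ℝ≥0∞ :=
  ⨅ (s : ℝ≥0) (_ : upperMinkowskiContent (s : ℝ) A = 0), (s : ℝ≥0∞)

/-- The bounded set `A ⊆ ℝ^N` has box dimension `d`: its lower and upper box dimensions
coincide and are equal to `d`. -/
def HasBoxDim {N : ℕ} (A : Set (EuclideanSpace ℝ (Fin N))) (d : ℝ≥0∞) : Prop :=
  Bornology.IsBounded A ∧ lowerBoxDim A = d ∧ upperBoxDim A = d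

/-- `f` is radially decreasing on `[φ₁, ∞)`: for every `φ ≥ φ₁` the sequence
`k ↦ f (φ + 2 k π)` is (strictly) decreasing. -/
def RadiallyDecreasing (f : ℝ → ℝ) (φ₁ : ℝ) : Prop :=
  ∀ φ ≥ φ₁, StrictAnti fun k : ℕ => f (φ + 2 * k * Real.pi)

/-- `f` is piecewise continuously differentiable on `[φ₁, ∞)`, with finitely many smooth
pieces in each compact interval `[φ₁, b]`: there is a set `S` of break points, finite in each
`[φ₁, b]`, such that `f` is continuously differentiable on the (open) complement of `S`
in `(φ₁, ∞)`. -/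
def PiecewiseC1 (f : ℝ → ℝ) (φ₁ : ℝ) : Prop :=
  ∃ S : Set ℝ, (∀ b > φ₁, (S ∩ Set.Icc φ₁ b).Finite) ∧ ContDiffOn ℝ 1 f (Set.Ioi φ₁ \ S)

/-- The graph of `r = f(φ)`, `φ ≥ φ₁`, in polar coordinates. -/
noncomputable def polarGraph (f : ℝ → ℝ) (φ₁ : ℝ) : Set (EuclideanSpace ℝ (Fin 2)) :=
  (fun φ : ℝ => !₂[f φ * Real.cos φ, f φ * Real.sin φ]) '' Set.Ici φ₁

/-! Put `ε = T ^ (-α - 1)`, the order of the gap between consecutive turns near angle `T`. Beyond a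
fixed multiple of `T` the turns are closer than `ε`, so the `ε`-neighbourhood contains a disc of
radius of order `T ^ (-α)` (`ball_subset_thickening_polarGraph`, with the gaps bounded by
`sub_add_two_pi_le`). Conversely, the turns beyond `T` lie in a disc of that order, while the arc up
to `T` has length of order at most `T ^ (1 - α)`, so its neighbourhood has area at most of order `T
^ (1 - α) * ε = T ^ (-2α)` (`volume_thickening_polarGraph_le`). Hence the area is comparable to `T ^
(-2α) = ε ^ (2 - 2 / (1 + α))`, and `hasBoxDim_of_volume_thickening` reads off the dimension. -/

/-! ### Box dimension from volume asymptotics. -/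

lemma lowerBoxDim_le_upperBoxDim {N : ℕ} (A : Set (EuclideanSpace ℝ (Fin N))) :
    lowerBoxDim A ≤ upperBoxDim A := by
  refine le_iInf₂ fun s hs => iInf₂_le s ?_
  exact le_antisymm (hs ▸ Filter.liminf_le_limsup) bot_le

lemma minkowskiQuotient_le {N : ℕ} {A : Set (EuclideanSpace ℝ (Fin N))} {s d C ε : ℝ}
    (hε : 0 < ε)
    (h : MeasureTheory.volume (Metric.thickening ε A) ≤ ENNReal.ofReal (C * ε ^ ((N : ℝ) - d))) :
    minkowskiQuotient s A ε ≤ ENNReal.ofReal (C * ε ^ (s - d)) := by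
  have hpos : 0 < ε ^ ((N : ℝ) - s) := Real.rpow_pos_of_pos hε _
  unfold minkowskiQuotient
  refine ENNReal.div_le_of_le_mul (h.trans_eq ?_)
  rw [← ENNReal.ofReal_mul' hpos.le, mul_assoc, ← Real.rpow_add hε]
  ring_nf

lemma le_minkowskiQuotient {N : ℕ} {A : Set (EuclideanSpace ℝ (Fin N))} {s d c ε : ℝ}
    (hε : 0 < ε)
    (h : ENNReal.ofReal (c * ε ^ ((N : ℝ) - d)) ≤ MeasureTheory.volume (Metric.thickening ε A)) :
    ENNReal.ofReal (c * ε ^ (s - d)) ≤ minkowskiQuotient s A ε := by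
  have hpos : 0 < ε ^ ((N : ℝ) - s) := Real.rpow_pos_of_pos hε _
  unfold minkowskiQuotient
  rw [ENNReal.le_div_iff_mul_le (Or.inl (by simpa using hpos)) (Or.inl ENNReal.ofReal_ne_top)]
  refine le_trans (le_of_eq ?_) h
  rw [← ENNReal.ofReal_mul' hpos.le, mul_assoc, ← Real.rpow_add hε]
  ring_nf

/-- A bounded set whose `ε`-neighbourhoods have volume comparable to `ε ^ (N - d)` has box
dimension `d`. -/
theorem hasBoxDim_of_volume_thickening {N : ℕ} {A : Set (EuclideanSpace ℝ (Fin N))}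
    (hA : Bornology.IsBounded A) {d c C : ℝ} (hd : 0 ≤ d) (hc : 0 < c)
    (hlo : ∀ᶠ ε in 𝓝[>] (0 : ℝ),
      ENNReal.ofReal (c * ε ^ ((N : ℝ) - d)) ≤ MeasureTheory.volume (Metric.thickening ε A))
    (hhi : ∀ᶠ ε in 𝓝[>] (0 : ℝ),
      MeasureTheory.volume (Metric.thickening ε A) ≤ ENNReal.ofReal (C * ε ^ ((N : ℝ) - d))) :
    HasBoxDim A (ENNReal.ofReal d) := by
  have hpos : ∀ᶠ ε in 𝓝[>] (0 : ℝ), 0 < ε := eventually_mem_nhdsWithin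
  have hlower : ENNReal.ofReal d ≤ lowerBoxDim A := by
    refine le_iInf₂ fun s hs => ?_
    by_contra! hlt
    have hsd : (s : ℝ) < d := by
      rw [← ENNReal.ofReal_coe_nnreal] at hlt
      exact (ENNReal.ofReal_lt_ofReal_iff_of_nonneg s.2).1 hlt
    have hlt1 : ∀ᶠ ε in 𝓝[>] (0 : ℝ), ε < 1 :=
      nhdsWithin_le_nhds (eventually_lt_nhds one_pos)
    have hle : ENNReal.ofReal c ≤ lowerMinkowskiContent (s : ℝ) A := by
      refine Filter.le_liminf_of_le (h := ?_)
      filter_upwards [hlo, hpos, hlt1] with ε h h0 h1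
      refine le_trans (ENNReal.ofReal_le_ofReal ?_) (le_minkowskiQuotient h0 h)
      exact le_mul_of_one_le_right hc.le
        (Real.one_le_rpow_of_pos_of_le_one_of_nonpos h0 h1.le (by linarith))
    rw [hs] at hle
    exact absurd hle (by simpa using hc)
  have hupper : upperBoxDim A ≤ ENNReal.ofReal d := by
    refine le_of_forall_gt_imp_ge_of_dense fun t ht => ?_
    rcases eq_or_ne t ⊤ with rfl | htop
    · exact le_top
    lift t to ℝ≥0 using htop
    have hdt : d < t := by
      rw [← ENNReal.ofReal_coe_nnreal] at ht
      exact (ENNReal.ofReal_lt_ofReal_iff_of_nonneg hd).1 ht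
    suffices h : upperMinkowskiContent (t : ℝ) A = 0 from iInf₂_le t h
    refine Filter.Tendsto.limsup_eq ?_
    have hlim : Filter.Tendsto (fun ε : ℝ => ENNReal.ofReal (C * ε ^ ((t : ℝ) - d)))
        (𝓝[>] (0 : ℝ)) (𝓝 0) := by
      have h0 : Filter.Tendsto (fun ε : ℝ => C * ε ^ ((t : ℝ) - d)) (𝓝[>] (0 : ℝ)) (𝓝 0) := by
        have h1 : Filter.Tendsto (fun ε : ℝ => ε ^ ((t : ℝ) - d)) (𝓝 0) (𝓝 (0 ^ ((t : ℝ) - d))) :=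
          (Real.continuousAt_rpow_const 0 _ (Or.inr (by linarith))).tendsto
        rw [Real.zero_rpow (by linarith)] at h1
        simpa using (h1.const_mul C).mono_left nhdsWithin_le_nhds
      simpa using ENNReal.tendsto_ofReal h0
    refine tendsto_of_tendsto_of_tendsto_of_le_of_le' tendsto_const_nhds hlim
      (Filter.Eventually.of_forall fun _ => bot_le) ?_
    filter_upwards [hhi, hpos] with ε h h0 using minkowskiQuotient_le h0 h
  exact ⟨hA, le_antisymm ((lowerBoxDim_le_upperBoxDim A).trans hupper) hlower,
    le_antisymm hupper (hlower.trans (lowerBoxDim_le_upperBoxDim A))⟩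

/-! ### Polar coordinates in the plane. -/

/-- Move radially at angle `θ`, then along a chord of the circle of radius `|s|`; `1 - x ^ 2 / 2 ≤
cos x` bounds the chord by its arc. -/
lemma dist_polar_le (r s θ ψ : ℝ) :
    dist (!₂[r * Real.cos θ, r * Real.sin θ] : EuclideanSpace ℝ (Fin 2))
      !₂[s * Real.cos ψ, s * Real.sin ψ] ≤ |r - s| + |s| * |θ - ψ| := by
  refine (dist_triangle _ !₂[s * Real.cos θ, s * Real.sin θ] _).trans (add_le_add ?_ ?_)
  · rw [EuclideanSpace.dist_eq]
    refine Real.sqrt_le_iff.2 ⟨abs_nonneg _, le_of_eq ?_⟩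
    simp only [Fin.sum_univ_two, Real.dist_eq, sq_abs, Matrix.cons_val_zero,
      Matrix.cons_val_one]
    linear_combination (r - s) ^ 2 * Real.sin_sq_add_cos_sq θ
  · rw [EuclideanSpace.dist_eq]
    refine Real.sqrt_le_iff.2 ⟨by positivity, ?_⟩
    simp only [Fin.sum_univ_two, Real.dist_eq, sq_abs, Matrix.cons_val_zero,
      Matrix.cons_val_one, mul_pow]
    have h := mul_le_mul_of_nonneg_left (Real.one_sub_sq_div_two_le_cos (x := θ - ψ))
      (sq_nonneg s)
    rw [Real.cos_sub] at h
    have e : (s * Real.cos θ - s * Real.cos ψ) ^ 2 + (s * Real.sin θ - s * Real.sin ψ) ^ 2 =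
        s ^ 2 * (2 - 2 * (Real.cos θ * Real.cos ψ + Real.sin θ * Real.sin ψ)) := by
      linear_combination s ^ 2 * Real.sin_sq_add_cos_sq θ + s ^ 2 * Real.sin_sq_add_cos_sq ψ
    rw [e]
    linarith

lemma norm_polar (r θ : ℝ) :
    ‖(!₂[r * Real.cos θ, r * Real.sin θ] : EuclideanSpace ℝ (Fin 2))‖ = |r| := by
  rw [EuclideanSpace.norm_eq, ← Real.sqrt_sq_eq_abs]
  congr 1
  simp only [Fin.sum_univ_two, Real.norm_eq_abs, sq_abs, Matrix.cons_val_zero,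
      Matrix.cons_val_one]
  linear_combination r ^ 2 * Real.sin_sq_add_cos_sq θ

/-- The free `b` allows the angle to be taken in a prescribed turn of the spiral. -/
lemma exists_polar_eq (p : EuclideanSpace ℝ (Fin 2)) (b : ℝ) :
    ∃ θ ∈ Set.Ico b (b + 2 * Real.pi), p = !₂[‖p‖ * Real.cos θ, ‖p‖ * Real.sin θ] := by
  obtain ⟨m, hm, -⟩ := existsUnique_add_zsmul_mem_Ico Real.two_pi_pos
    (Complex.arg ⟨p 0, p 1⟩) b
  refine ⟨_, hm, ?_⟩
  have hn : ‖p‖ = ‖(⟨p 0, p 1⟩ : ℂ)‖ := by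
    rw [EuclideanSpace.norm_eq, Complex.norm_def, Complex.normSq_mk]
    simp [Fin.sum_univ_two, sq]
  rw [zsmul_eq_mul, Real.cos_add_int_mul_two_pi, Real.sin_add_int_mul_two_pi, hn,
    Complex.norm_mul_cos_arg, Complex.norm_mul_sin_arg]
  ext i
  fin_cases i <;> simp

lemma polarGraph_isBounded {f : ℝ → ℝ} {φ₁ : ℝ} (hpos : ∀ φ ≥ φ₁, 0 < f φ)
    (hanti : AntitoneOn f (Set.Ici φ₁)) : Bornology.IsBounded (polarGraph f φ₁) := by
  refine isBounded_iff_forall_norm_le.2 ⟨f φ₁, ?_⟩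
  rintro _ ⟨φ, hφ, rfl⟩
  rw [norm_polar, abs_of_pos (hpos φ hφ)]
  exact hanti (Set.mem_Ici.2 le_rfl) hφ hφ

/-! ### Upper bound for the gap between turns. -/

/-- The mean value inequality with finitely many exceptional points. -/
lemma sub_le_mul_of_deriv_le_of_finite {f : ℝ → ℝ} {C : ℝ} (S : Finset ℝ) :
    ∀ a b : ℝ, a ≤ b → ContinuousOn f (Set.Icc a b) →
      (∀ x ∈ Set.Ioo a b, x ∉ S → DifferentiableAt ℝ f x ∧ |deriv f x| ≤ C) →
      f a - f b ≤ C * (b - a) := by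
  induction S using Finset.induction_on with
  | empty =>
    intro a b hab hc hd
    rcases hab.eq_or_lt with rfl | hlt
    · simp
    obtain ⟨x, hx, he⟩ := exists_deriv_eq_slope f hlt hc
      fun x hx => (hd x hx (by simp)).1.differentiableWithinAt
    have h := neg_le_of_abs_le (hd x hx (by simp)).2
    rw [he, le_div_iff₀ (sub_pos.2 hlt)] at h
    linarith
  | insert s T _ ih =>
    intro a b hab hc hd
    -- An interior exceptional point is removed by splitting the interval there; the two estimates
    -- add up.
    by_cases hs : s ∈ Set.Ioo a b
    · have h1 := ih a s hs.1.le (hc.mono (Set.Icc_subset_Icc_right hs.2.le)) fun x hx hxT =>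
        hd x ⟨hx.1, hx.2.trans hs.2⟩ (by simp [hx.2.ne, hxT])
      have h2 := ih s b hs.2.le (hc.mono (Set.Icc_subset_Icc_left hs.1.le)) fun x hx hxT =>
        hd x ⟨hs.1.trans hx.1, hx.2⟩ (by simp [hx.1.ne', hxT])
      linarith
    · refine ih a b hab hc fun x hx hxT => hd x hx ?_
      rw [Finset.mem_insert, not_or]
      exact ⟨fun h => hs (h ▸ hx), hxT⟩

lemma PiecewiseC1.exists_finset_differentiableAt {f : ℝ → ℝ} {φ₁ : ℝ} (h : PiecewiseC1 f φ₁)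
    (b : ℝ) : ∃ F : Finset ℝ, ∀ x ∈ Set.Ioo φ₁ b, x ∉ F → DifferentiableAt ℝ f x := by
  obtain ⟨S, hfin, hS⟩ := h
  rcases le_or_gt b φ₁ with hb | hb
  · exact ⟨∅, fun x hx => absurd (hx.1.trans hx.2) hb.not_gt⟩
  refine ⟨(hfin b hb).toFinset, fun x hx hxF => ?_⟩
  rw [Set.Finite.mem_toFinset] at hxF
  have hmem : Set.Ioo φ₁ b ∩ (S ∩ Set.Icc φ₁ b)ᶜ ∈ 𝓝 x :=
    Filter.inter_mem (Ioo_mem_nhds hx.1 hx.2) ((hfin b hb).isClosed.isOpen_compl.mem_nhds hxF)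
  refine (hS.differentiableOn one_ne_zero).differentiableAt (Filter.mem_of_superset hmem ?_)
  exact fun y hy => ⟨hy.1.1, fun hyS => hy.2 ⟨hyS, Set.Ioo_subset_Icc_self hy.1⟩⟩

/-- The derivative bound decreases in the angle, so over one turn its value at the left end serves
throughout. -/
lemma sub_add_two_pi_le {f : ℝ → ℝ} {φ₁ α M : ℝ} (hα₀ : 0 < α) (hφ₁ : 0 < φ₁) (hM : 0 < M)
    (hcont : ContinuousOn f (Set.Ici φ₁)) (hC1 : PiecewiseC1 f φ₁)
    (hderiv : ∀ φ > φ₁, DifferentiableAt ℝ f φ → |deriv f φ| ≤ M * φ ^ (-α - 1))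
    {φ : ℝ} (hφ : φ₁ ≤ φ) :
    f φ - f (φ + 2 * Real.pi) ≤ 2 * Real.pi * M * φ ^ (-α - 1) := by
  obtain ⟨F, hF⟩ := hC1.exists_finset_differentiableAt (φ + 2 * Real.pi)
  have h := sub_le_mul_of_deriv_le_of_finite (f := f) (C := M * φ ^ (-α - 1)) F φ
    (φ + 2 * Real.pi) (by linarith [Real.pi_pos])
    (hcont.mono fun x hx => hφ.trans hx.1) fun x hx hxF => by
      have hx1 : φ₁ < x := hφ.trans_lt hx.1
      have hd := hF x ⟨hx1, hx.2⟩ hxF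
      refine ⟨hd, (hderiv x hx1 hd).trans (mul_le_mul_of_nonneg_left ?_ hM.le)⟩
      exact Real.rpow_le_rpow_of_nonpos (hφ₁.trans_le hφ) hx.1.le (by linarith)
  linarith

/-! ### The filled disc at the centre. -/

/-- If consecutive turns of the spiral beyond angle `b` are less than `ε` apart, then its
`ε`-neighbourhood contains a full disc. -/
lemma ball_subset_thickening_polarGraph {f : ℝ → ℝ} {φ₁ b ε : ℝ} (hε : 0 < ε)
    (hb : φ₁ ≤ b) (hanti : AntitoneOn f (Set.Ici φ₁))
    (hlim : Filter.Tendsto f Filter.atTop (𝓝 0))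
    (hgap : ∀ φ ≥ b, f φ - f (φ + 2 * Real.pi) < ε) :
    Metric.ball 0 (f (b + 2 * Real.pi)) ⊆ Metric.thickening ε (polarGraph f φ₁) := by
  intro p hp
  rw [mem_ball_zero_iff] at hp
  obtain ⟨θ, hθ, hpθ⟩ := exists_polar_eq p b
  have hπ := Real.pi_pos
  have hangle (k : ℕ) : θ ≤ θ + k * (2 * Real.pi) := le_add_of_nonneg_right (by positivity)
  have hex : ∃ k : ℕ, f (θ + k * (2 * Real.pi)) < ‖p‖ + ε := by
    have ht : Filter.Tendsto (fun k : ℕ => θ + k * (2 * Real.pi)) Filter.atTop Filter.atTop :=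
      Filter.tendsto_atTop_add_const_left _ _
        (tendsto_natCast_atTop_atTop.atTop_mul_const Real.two_pi_pos)
    exact ((hlim.comp ht).eventually_lt_const (by positivity : 0 < ‖p‖ + ε)).exists
  classical
  -- On the ray of `p`, take the first turn with radius below `‖p‖ + ε`. The previous radius is at
  -- least `‖p‖ + ε` and the drop is less than `ε`, so this radius exceeds `‖p‖ - ε`. The threshold
  -- is positive even for `p = 0`.
  obtain ⟨k, hk, hmin⟩ : ∃ k : ℕ, f (θ + k * (2 * Real.pi)) < ‖p‖ + ε ∧
      ∀ j < k, ‖p‖ + ε ≤ f (θ + j * (2 * Real.pi)) :=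
    ⟨Nat.find hex, Nat.find_spec hex, fun j hj => not_lt.1 (Nat.find_min hex hj)⟩
  have hk' : ‖p‖ - ε < f (θ + k * (2 * Real.pi)) := by
    cases k with
    | zero =>
      have : f (b + 2 * Real.pi) ≤ f θ :=
        hanti (hb.trans hθ.1) (by simp only [Set.mem_Ici]; linarith) hθ.2.le
      simp only [Nat.cast_zero, zero_mul, add_zero]
      linarith
    | succ j =>
      have h1 := hmin j (Nat.lt_succ_self j)
      have h2 := hgap (θ + j * (2 * Real.pi)) (hθ.1.trans (hangle j))
      have e : θ + j * (2 * Real.pi) + 2 * Real.pi = θ + ((j + 1 : ℕ) : ℝ) * (2 * Real.pi) := by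
        push_cast; ring
      rw [e] at h2
      linarith
  refine Metric.mem_thickening_iff.2 ⟨_, ⟨θ + k * (2 * Real.pi),
    hb.trans (hθ.1.trans (hangle k)), rfl⟩, ?_⟩
  simp only [Real.cos_add_nat_mul_two_pi, Real.sin_add_nat_mul_two_pi]
  rw [hpθ]
  refine (dist_polar_le _ _ _ _).trans_lt ?_
  rw [sub_self, abs_zero, mul_zero, add_zero, abs_lt]
  constructor <;> linarith

/-! ### Upper bound for the area. -/

lemma volume_ball_euclidean_plane {r : ℝ} (hr : 0 ≤ r) (p : EuclideanSpace ℝ (Fin 2)) :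
    MeasureTheory.volume (Metric.ball p r) = ENNReal.ofReal (Real.pi * r ^ 2) := by
  rw [EuclideanSpace.volume_ball_fin_two, ← ENNReal.ofReal_pow hr,
    ENNReal.ofReal_mul Real.pi_pos.le, mul_comm]

/-- The `ε`-neighbourhood of a curve with bounded arc length function has area of order `ε`. -/
lemma volume_thickening_image_le {ι : Type*} {g : ι → EuclideanSpace ℝ (Fin 2)} {s : Set ι}
    {L : ι → ℝ} {l ε : ℝ} (hε : 0 < ε) (hL : ∀ x ∈ s, 0 ≤ L x ∧ L x ≤ l) (hl : 0 ≤ l)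
    (hg : ∀ x ∈ s, ∀ y ∈ s, dist (g x) (g y) ≤ |L x - L y|) :
    MeasureTheory.volume (Metric.thickening ε (g '' s)) ≤
      ENNReal.ofReal (4 * Real.pi * (l * ε + ε ^ 2)) := by
  -- Cut the curve into pieces on which `L` varies by less than `ε`; an empty piece gets the dummy
  -- centre `0`.
  have hc (j : ℕ) : ∃ p, ∀ x ∈ s, ⌊L x / ε⌋₊ = j → dist (g x) p < ε := by
    by_cases h : ∃ x ∈ s, ⌊L x / ε⌋₊ = j
    · obtain ⟨x, hx, hxj⟩ := h
      refine ⟨g x, fun y hy hyj => (hg y hy x hx).trans_lt ?_⟩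
      have hx0 := div_nonneg (hL x hx).1 hε.le
      have hy0 := div_nonneg (hL y hy).1 hε.le
      have hx1 := (Nat.floor_eq_iff hx0).1 hxj
      have hy1 := (Nat.floor_eq_iff hy0).1 hyj
      rw [le_div_iff₀ hε, div_lt_iff₀ hε] at hx1 hy1
      rw [abs_lt]
      constructor <;> linarith
    · exact ⟨0, fun x hx hxj => absurd ⟨x, hx, hxj⟩ h⟩
  choose c hc using hc
  have hsub : Metric.thickening ε (g '' s) ⊆
      ⋃ j ∈ Finset.range (⌊l / ε⌋₊ + 1), Metric.ball (c j) (2 * ε) := by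
    intro y hy
    obtain ⟨_, ⟨x, hx, rfl⟩, hyx⟩ := Metric.mem_thickening_iff.1 hy
    refine Set.mem_iUnion₂.2 ⟨⌊L x / ε⌋₊, ?_, ?_⟩
    · rw [Finset.mem_range, Nat.lt_succ_iff]
      exact Nat.floor_mono (div_le_div_of_nonneg_right (hL x hx).2 hε.le)
    · have := dist_triangle y (g x) (c ⌊L x / ε⌋₊)
      have := hc _ x hx rfl
      rw [Metric.mem_ball]
      linarith
  refine (MeasureTheory.measure_mono hsub).trans
    ((MeasureTheory.measure_biUnion_finset_le _ _).trans ?_)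
  simp only [volume_ball_euclidean_plane (by positivity : 0 ≤ 2 * ε), Finset.sum_const,
    Finset.card_range, nsmul_eq_mul]
  rw [← ENNReal.ofReal_natCast, ← ENNReal.ofReal_mul (by positivity)]
  refine ENNReal.ofReal_le_ofReal ?_
  have h1 : ((⌊l / ε⌋₊ + 1 : ℕ) : ℝ) ≤ l / ε + 1 := by
    push_cast
    linarith [Nat.floor_le (div_nonneg hl hε.le)]
  refine (mul_le_mul_of_nonneg_right h1 (by positivity)).trans_eq ?_
  field_simp
  ring

/-- Bernoulli's inequality for `(x / y) ^ (1 - α)`; it replaces integrating `φ ^ (-α)` in the length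
estimate. -/
lemma mul_rpow_neg_mul_sub_le {α x y : ℝ} (hα₀ : 0 < α) (hα₁ : α < 1) (hx : 0 < x)
    (hxy : x ≤ y) : (1 - α) * y ^ (-α) * (y - x) ≤ y ^ (1 - α) - x ^ (1 - α) := by
  have hy : 0 < y := hx.trans_le hxy
  have h := rpow_one_add_le_one_add_mul_self (s := x / y - 1) (p := 1 - α)
    (by linarith [div_pos hx hy]) (by linarith) (by linarith)
  rw [add_sub_cancel, Real.div_rpow hx.le hy.le,
    div_le_iff₀ (Real.rpow_pos_of_pos hy _)] at h
  have e : y ^ (1 - α) = y ^ (-α) * y := by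
    rw [sub_eq_neg_add, Real.rpow_add_one hy.ne']
  have e2 : (1 + (1 - α) * (x / y - 1)) * y ^ (1 - α) =
      y ^ (1 - α) + (1 - α) * y ^ (-α) * (x - y) := by
    rw [e]; field_simp
  rw [e2] at h
  linarith

lemma volume_thickening_polarGraph_le {f : ℝ → ℝ} {α φ₁ m ε T : ℝ} (hα₀ : 0 < α) (hα₁ : α < 1)
    (hφ₁ : 0 < φ₁) (hpos : ∀ φ ≥ φ₁, 0 < f φ) (hanti : AntitoneOn f (Set.Ici φ₁)) (hm : 0 < m)
    (hf : ∀ φ ≥ φ₁, f φ ≤ m * φ ^ (-α)) (hT : φ₁ ≤ T) (hε : 0 < ε) :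
    MeasureTheory.volume (Metric.thickening ε (polarGraph f φ₁)) ≤
      ENNReal.ofReal (4 * Real.pi * ((m / (1 - α) * T ^ (1 - α) + f φ₁) * ε + ε ^ 2) +
        Real.pi * (m * T ^ (-α) + ε) ^ 2) := by
  have hα : 0 < 1 - α := by linarith
  have hT0 : 0 < T := hφ₁.trans_le hT
  set g : ℝ → EuclideanSpace ℝ (Fin 2) := fun φ => !₂[f φ * Real.cos φ, f φ * Real.sin φ]
  -- A majorant of arc length: an antiderivative of `m * φ ^ (-α)` for the angular motion plus the
  -- total radial decrease.
  set L : ℝ → ℝ := fun φ => m / (1 - α) * φ ^ (1 - α) + (f φ₁ - f φ)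
  have hg : ∀ x ∈ Set.Icc φ₁ T, ∀ y ∈ Set.Icc φ₁ T, dist (g x) (g y) ≤ |L x - L y| := by
    intro x hx y hy
    -- With `y` the larger angle, `dist_polar_le` weights the angular part by `f y ≤ m * y ^ (-α)`,
    -- as the Bernoulli estimate requires.
    wlog hxy : x ≤ y generalizing x y
    · rw [dist_comm, abs_sub_comm]
      exact this y hy x hx (le_of_not_ge hxy)
    have h1 := hanti hx.1 hy.1 hxy
    have h2 := mul_rpow_neg_mul_sub_le hα₀ hα₁ (hφ₁.trans_le hx.1) hxy
    have h3 : f y * (y - x) ≤ m / (1 - α) * (y ^ (1 - α) - x ^ (1 - α)) := by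
      refine (mul_le_mul_of_nonneg_right (hf y hy.1) (sub_nonneg.2 hxy)).trans ?_
      refine le_trans (le_of_eq ?_) (mul_le_mul_of_nonneg_left h2 (by positivity))
      field_simp
    refine (dist_polar_le _ _ _ _).trans ?_
    rw [abs_of_nonneg (sub_nonneg.2 h1), abs_of_pos (hpos y hy.1), abs_sub_comm x y,
      abs_of_nonneg (sub_nonneg.2 hxy), abs_sub_comm]
    refine le_trans ?_ (le_abs_self _)
    simp only [L]
    linarith
  have hL : ∀ x ∈ Set.Icc φ₁ T, 0 ≤ L x ∧ L x ≤ m / (1 - α) * T ^ (1 - α) + f φ₁ := by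
    intro x hx
    have hx0 : 0 < x := hφ₁.trans_le hx.1
    have h1 := hanti (Set.mem_Ici.2 le_rfl) hx.1 hx.1
    have h2 := hpos x hx.1
    have h3 : m / (1 - α) * x ^ (1 - α) ≤ m / (1 - α) * T ^ (1 - α) :=
      mul_le_mul_of_nonneg_left (Real.rpow_le_rpow hx0.le hx.2 hα.le) (by positivity)
    have h4 : 0 ≤ m / (1 - α) * x ^ (1 - α) := by positivity
    constructor <;> simp only [L] <;> linarith
  have hf1 := hpos φ₁ le_rfl
  have hsub : Metric.thickening ε (polarGraph f φ₁) ⊆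
      Metric.thickening ε (g '' Set.Icc φ₁ T) ∪ Metric.ball 0 (m * T ^ (-α) + ε) := by
    intro p hp
    obtain ⟨_, ⟨φ, hφ, rfl⟩, hpφ⟩ := Metric.mem_thickening_iff.1 hp
    rcases le_total φ T with h | h
    · exact Or.inl (Metric.mem_thickening_iff.2 ⟨_, ⟨φ, ⟨hφ, h⟩, rfl⟩, hpφ⟩)
    · right
      have h1 : f φ ≤ m * T ^ (-α) := (hf φ hφ).trans
        (mul_le_mul_of_nonneg_left (Real.rpow_le_rpow_of_nonpos hT0 h (by linarith)) hm.le)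
      have h2 := dist_triangle p (g φ) 0
      rw [dist_zero_right (g φ), norm_polar, abs_of_pos (hpos φ hφ)] at h2
      rw [Metric.mem_ball]
      have hpφ' : dist p (g φ) < ε := hpφ
      linarith
  refine (MeasureTheory.measure_mono hsub).trans ((MeasureTheory.measure_union_le _ _).trans ?_)
  rw [ENNReal.ofReal_add (by positivity) (by positivity),
    ← volume_ball_euclidean_plane (by positivity) 0]
  exact add_le_add_left (volume_thickening_image_le hε hL (by positivity) hg) _

/-! ### Lower bound for the area. -/

lemma le_volume_thickening_polarGraph {f : ℝ → ℝ} {α φ₁ m B T : ℝ} (hα₀ : 0 < α)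
    (hφ₁ : 0 < φ₁) (hanti : AntitoneOn f (Set.Ici φ₁))
    (hlim : Filter.Tendsto f Filter.atTop (𝓝 0)) (hm : 0 < m) (hB : 0 < B)
    (hf : ∀ φ ≥ φ₁, m * φ ^ (-α) ≤ f φ)
    (hgap : ∀ φ ≥ φ₁, f φ - f (φ + 2 * Real.pi) ≤ B * φ ^ (-α - 1))
    (hT : φ₁ ≤ T) (hT' : 2 * Real.pi ≤ T) :
    ENNReal.ofReal (Real.pi * (m * (B + 2) ^ (-α)) ^ 2 * T ^ (-(2 * α))) ≤
      MeasureTheory.volume (Metric.thickening (T ^ (-α - 1)) (polarGraph f φ₁)) := by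
  have hT0 : 0 < T := hφ₁.trans_le hT
  have hπ := Real.pi_pos
  -- Starting at `(B + 1) * T` makes every later gap at most `B / (B + 1) * T ^ (-α - 1)`, strictly
  -- below `ε`.
  have hb : φ₁ ≤ (B + 1) * T := hT.trans (le_mul_of_one_le_left hT0.le (by linarith))
  have hb2 : φ₁ ≤ (B + 1) * T + 2 * Real.pi := by linarith
  have hsub := ball_subset_thickening_polarGraph (Real.rpow_pos_of_pos hT0 (-α - 1)) hb hanti hlim
    fun φ hφ => by
      have h1 : φ ^ (-α - 1) ≤ ((B + 1) * T) ^ (-α - 1) :=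
        Real.rpow_le_rpow_of_nonpos (by positivity) hφ (by linarith)
      have h2 : (B + 1) ^ (-α - 1) ≤ (B + 1)⁻¹ := by
        rw [← Real.rpow_neg_one]
        exact Real.rpow_le_rpow_of_exponent_le (by linarith) (by linarith)
      rw [Real.mul_rpow (by positivity) hT0.le] at h1
      have hTp := Real.rpow_pos_of_pos hT0 (-α - 1)
      calc f φ - f (φ + 2 * Real.pi) ≤ B * φ ^ (-α - 1) := hgap φ (hb.trans hφ)
        _ ≤ B * ((B + 1)⁻¹ * T ^ (-α - 1)) :=
          mul_le_mul_of_nonneg_left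
            (h1.trans (mul_le_mul_of_nonneg_right h2 hTp.le)) hB.le
        _ = B / (B + 1) * T ^ (-α - 1) := by ring
        _ < T ^ (-α - 1) :=
          mul_lt_of_lt_one_left hTp ((div_lt_one (by linarith)).2 (by linarith))
  -- `2 * π ≤ T` absorbs the extra turn: `(B + 1) * T + 2 * π ≤ (B + 2) * T`.
  have hr : m * (B + 2) ^ (-α) * T ^ (-α) ≤ f ((B + 1) * T + 2 * Real.pi) := by
    refine le_trans ?_ (hf _ hb2)
    rw [mul_assoc, ← Real.mul_rpow (by positivity) hT0.le]
    exact mul_le_mul_of_nonneg_left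
      (Real.rpow_le_rpow_of_nonpos (by positivity) (by linarith) (by linarith)) hm.le
  refine le_trans (le_of_eq ?_)
    (MeasureTheory.measure_mono ((Metric.ball_subset_ball hr).trans hsub))
  rw [volume_ball_euclidean_plane (by positivity), mul_pow (m * _), ← Real.rpow_mul_natCast hT0.le,
    mul_assoc]
  congr 4
  push_cast
  ring

/-! ### Conclusion. -/

theorem theorem2 (α φ₁ : ℝ) (hα₀ : 0 < α) (hα₁ : α < 1) (hφ₁ : 0 < φ₁)
    (f : ℝ → ℝ)
    (hpos : ∀ φ ≥ φ₁, 0 < f φ)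
    (hanti : AntitoneOn f (Set.Ici φ₁))
    (hrad : RadiallyDecreasing f φ₁)
    (hcont : ContinuousOn f (Set.Ici φ₁))
    (hC1 : PiecewiseC1 f φ₁)
    (m_lo m_hi a M : ℝ) (hm_lo : 0 < m_lo) (hm_hi : 0 < m_hi) (ha : 0 < a) (hM : 0 < M)
    (hf : ∀ φ ≥ φ₁, m_lo * φ ^ (-α) ≤ f φ ∧ f φ ≤ m_hi * φ ^ (-α))
    (hgap : ∀ φ ≥ φ₁, a * φ ^ (-α - 1) ≤ f φ - f (φ + 2 * Real.pi))
    (hderiv : ∀ φ > φ₁, DifferentiableAt ℝ f φ → |deriv f φ| ≤ M * φ ^ (-α - 1)) :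
    HasBoxDim (polarGraph f φ₁) (ENNReal.ofReal (2 / (1 + α))) := by
  have hα : 0 < 1 - α := by linarith
  have hπ := Real.pi_pos
  have hlim : Filter.Tendsto f Filter.atTop (𝓝 0) := by
    have h : Filter.Tendsto (fun φ : ℝ => m_hi * φ ^ (-α)) Filter.atTop (𝓝 0) := by
      simpa using (tendsto_rpow_neg_atTop hα₀).const_mul m_hi
    refine tendsto_of_tendsto_of_tendsto_of_le_of_le' tendsto_const_nhds h ?_ ?_
    · filter_upwards [Filter.eventually_ge_atTop φ₁] with φ hφ using (hpos φ hφ).le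
    · filter_upwards [Filter.eventually_ge_atTop φ₁] with φ hφ using (hf φ hφ).2
  -- The two-sided bound is proved in terms of `T`, where `ε = T ^ (-α - 1)`.
  have hT : ∀ᶠ ε in 𝓝[>] (0 : ℝ), ∃ T, φ₁ ≤ T ∧ 2 * Real.pi ≤ T ∧ 1 ≤ T ∧
      ε = T ^ (-α - 1) ∧ T ^ (-(2 * α)) = ε ^ (((2 : ℕ) : ℝ) - 2 / (1 + α)) := by
    have ht : Filter.Tendsto (fun ε : ℝ => ε⁻¹ ^ (1 + α)⁻¹) (𝓝[>] (0 : ℝ)) Filter.atTop :=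
      (tendsto_rpow_atTop (by positivity)).comp tendsto_inv_nhdsGT_zero
    filter_upwards [ht.eventually_ge_atTop φ₁, ht.eventually_ge_atTop (2 * Real.pi),
      ht.eventually_ge_atTop 1, eventually_mem_nhdsWithin] with ε h1 h2 h3 h4
    have hε : (0 : ℝ) < ε := h4
    refine ⟨_, h1, h2, h3, ?_, ?_⟩
    · rw [← Real.rpow_mul (by positivity), Real.inv_rpow hε.le, ← Real.rpow_neg hε.le]
      convert (Real.rpow_one ε).symm using 2
      field_simp
      ring
    · rw [← Real.rpow_mul (by positivity), Real.inv_rpow hε.le, ← Real.rpow_neg hε.le]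
      congr 1
      push_cast
      field_simp
      ring
  refine hasBoxDim_of_volume_thickening (polarGraph_isBounded hpos hanti)
    (c := Real.pi * (m_lo * (2 * Real.pi * M + 2) ^ (-α)) ^ 2)
    (C := 4 * Real.pi * (m_hi / (1 - α) + f φ₁ + 1) + Real.pi * (m_hi + 1) ^ 2)
    (by positivity) (by positivity) ?_ ?_
  · filter_upwards [hT] with ε ⟨T, h1, h2, h3, hε, hTε⟩
    rw [← hTε, hε]
    exact le_volume_thickening_polarGraph hα₀ hφ₁ hanti hlim hm_lo (by positivity)
      (fun φ hφ => (hf φ hφ).1)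
      (fun φ hφ => sub_add_two_pi_le hα₀ hφ₁ hM hcont hC1 hderiv hφ) h1 h2
  · filter_upwards [hT] with ε ⟨T, h1, h2, h3, hε, hTε⟩
    have hT0 : 0 < T := one_pos.trans_le h3
    have hε0 : 0 < ε := hε ▸ Real.rpow_pos_of_pos hT0 _
    refine (volume_thickening_polarGraph_le hα₀ hα₁ hφ₁ hpos hanti hm_hi
      (fun φ hφ => (hf φ hφ).2) h1 hε0).trans (ENNReal.ofReal_le_ofReal ?_)
    rw [← hTε]
    -- Every term is compared with `T ^ (-2α)`; for those linear in `ε` this uses `T ≥ 1` and `α <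
    -- 1`.
    have e1 : T ^ (1 - α) * ε = T ^ (-(2 * α)) := by
      rw [hε, ← Real.rpow_add hT0]; ring_nf
    have e2 : ε ≤ T ^ (-(2 * α)) := by
      rw [hε]; exact Real.rpow_le_rpow_of_exponent_le h3 (by linarith)
    have e3 : ε ^ 2 ≤ ε := by
      have : ε ≤ 1 := hε ▸ Real.rpow_le_one_of_one_le_of_nonpos h3 (by linarith)
      nlinarith
    have e4 : ε ≤ T ^ (-α) := by
      rw [hε]; exact Real.rpow_le_rpow_of_exponent_le h3 (by linarith)
    have e5 : (T ^ (-α)) ^ 2 = T ^ (-(2 * α)) := by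
      rw [← Real.rpow_mul_natCast hT0.le]; congr 1; push_cast; ring
    have e6 : (m_hi * T ^ (-α) + ε) ^ 2 ≤ (m_hi + 1) ^ 2 * T ^ (-(2 * α)) := by
      rw [← e5, ← mul_pow]
      exact pow_le_pow_left₀ (by positivity) (by linarith) 2
    have e7 : (m_hi / (1 - α) * T ^ (1 - α) + f φ₁) * ε + ε ^ 2 ≤
        (m_hi / (1 - α) + f φ₁ + 1) * T ^ (-(2 * α)) := by
      have := mul_le_mul_of_nonneg_left e2 (hpos φ₁ le_rfl).le
      calc _ = m_hi / (1 - α) * (T ^ (1 - α) * ε) + f φ₁ * ε + ε ^ 2 := by ring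
        _ ≤ _ := by rw [e1]; linarith
    calc _ ≤ 4 * Real.pi * ((m_hi / (1 - α) + f φ₁ + 1) * T ^ (-(2 * α))) +
          Real.pi * ((m_hi + 1) ^ 2 * T ^ (-(2 * α))) :=
        add_le_add (mul_le_mul_of_nonneg_left e7 (by positivity))
          (mul_le_mul_of_nonneg_left e6 hπ.le)
      _ = _ := by ring
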